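/- **Theorem 6.5.** Let $d\ge 0$ and let $\alpha=(\alpha_1,\dots,\alpha_{d+1})\in\mathbb R^{d+1}$ and $\beta=(\beta_1,\dots,\beta_d)\in\mathbb R^d$ be strictly increasing sequences. Let $\mathscr T_{d,d}$ be the set of complete binary trees (plane rooted trees in which each internal vertex has a Left and a Right child) with $d$ internal vertices, hence with $d+1$ leaves $\ell_1,\dots,\ell_{d+1}$, enumerated from left to right. Label an internal vertex of $T\in\mathscr T_{d,d}$ by $i$ if it is the closest common ancestor of $\ell_i$ and $\ell_{i+1}$. For $1\le i\le d$ set $$\beta_{T,i}=\sum_{k=1}^{t}\beta_k-\sum_{k=1}^{a}\beta_k-\sum_{k=1}^{b}\beta_k ,$$ where $t$, $a$ and $b$ are the numbers of internal vertices of the subtree of $T$ rooted at the vertex labeled $i$, of the Left subtree and of the Right subtree of that vertex, respectively; put $\beta_{T,0}=\beta_{T,d+1}=0$. Suppose that $(\alpha,\beta)$ is a $\mathscr T$-appropriate pair, that is, for every $T\in\mathscr T_{d,d}$ the numbers $\alpha_i+\beta_{T,i-1}-\beta_{T,i}$ $(1\le i\le d+1)$ strictly increase with $i$. Let $$\operatorname{PermAsso}(\alpha,\beta)=\operatorname{ConvexHull}\Bigl\{\sum_{i=1}^{d+1}\alpha_i\,e_{\pi^{-1}(i)}+\sum_{i=1}^{d}\beta_{T,i}\bigl(e_{\pi^{-1}(i+1)}-e_{\pi^{-1}(i)}\bigr)\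 :\ \pi\in\mathfrak S_{d+1},\ T\in\mathscr T_{d,d}\Bigr\}\subseteq\mathbb R^{d+1},$$ and let $U_d^\alpha=\{x\in\mathbb R^{d+1}: \sum_i x_i=\sum_i\alpha_i\}$. Let $\overline{\mathscr O_{d+1}}$ be the set of ordered set partitions $\mathcal S=(S_1,\dots,S_k)$ of $\{1,\dots,d+1\}$ into $k\ge 2$ nonempty blocks. For such $\mathcal S$ let $e_{\mathcal S}=\sum_{i=1}^k i\sum_{j\in S_i}e_j$, let $t_i=|S_1|+\dots+|S_i|$ for $0\le i\le k$, and let $$b_{\mathcal S}=\Bigl(\sum_{i=1}^{k} i\sum_{j=t_{i-1}+1}^{t_i}\alpha_j\Bigr)+\Bigl(\sum_{j=1}^{d}\beta_j-\sum_{i=1}^{k}\ \sum_{j=1}^{|S_i|-1}\beta_j\Bigr).$$ Then $$\operatorname{PermAsso}(\alpha,\beta)=\bigl\{x\in U_d^\alpha:\ \langle e_{\mathcal S},x\rangle\le b_{\mathcal S}\ \text{ for all }\mathcal S\in\overline{\mathscr O_{d+1}}\bigr\},$$ and each of these inequalities is facet-defining: for every $\mathcal S\in\overline{\mathscr O_{d+1}}$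 the set $\{x\in\operatorname{PermAsso}(\alpha,\beta):\langle e_{\mathcal S},x\rangle=b_{\mathcal S}\}$ is a nonempty face of $\operatorname{PermAsso}(\alpha,\beta)$ of dimension $\dim\operatorname{PermAsso}(\alpha,\beta)-1$. -/

import Mathlib

open scoped Matrix

namespace NestedPermutoAssociahedron

noncomputable section

/-! ### Complete binary trees

A complete binary tree (plane, unlabeled, each internal vertex has a Left and a Right child) is a
term of `BinaryTree Unit`: `nil` is a leaf, `node` is an internal vertex, and `numNodes` counts the
internal vertices. The trees with `d` internal vertices (hence `d + 1` leaves) are those with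
`T.numNodes = d`. -/

/-- `prefixSum β t` is `β₁ + ⋯ + β_t` (for `t ≤ n`). -/
def prefixSum {n : ℕ} (β : Fin n → ℝ) (t : ℕ) : ℝ :=
  ∑ k : Fin n with k.val < t, β k

/-- `val(β, T)`: with `t`, `a`, `b` the numbers of internal vertices of `T`, of its Left subtree and
of its Right subtree, the number `∑_{k ≤ t} β_k - ∑_{k ≤ a} β_k - ∑_{k ≤ b} β_k`
(and `0` for a leaf). -/
def val {n : ℕ} (β : Fin n → ℝ) : BinaryTree Unit → ℝ
  | .nil => 0
  | .node u l r =>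
      prefixSum β (BinaryTree.node u l r).numNodes - prefixSum β l.numNodes
        - prefixSum β r.numNodes

/-- The subtree of `T` rooted at the internal vertex labeled `i`. The labels are `1, …, numNodes`:
an internal vertex is labeled `i` if it is the closest common ancestor of the `i`-th and the
`(i+1)`-st leaf, in left-to-right order. If the Left subtree of the root has `a` internal vertices,
it holds the leaves `1, …, a + 1`; so the closest common ancestor of the leaves `i` and `i + 1` lies
in the Left subtree if `i ≤ a`, is the root if `i = a + 1`, and lies in the Right subtree
otherwise. For `i` not in `1, …, numNodes` the value is a leaf. -/
def subtreeAt : BinaryTree Unit → ℕ → BinaryTree Unit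
  | .nil, _ => .nil
  | .node u l r, i =>
      if i ≤ l.numNodes then subtreeAt l i
      else if i = l.numNodes + 1 then .node u l r
      else subtreeAt r (i - (l.numNodes + 1))

/-- `β_{T,i} = val(β, T_{(i)})` for `1 ≤ i ≤ T.numNodes`. -/
def treeVal {n : ℕ} (β : Fin n → ℝ) (T : BinaryTree Unit) (i : ℕ) : ℝ :=
  val β (subtreeAt T i)

theorem subtreeAt_zero (T : BinaryTree Unit) : subtreeAt T 0 = .nil := by
  induction T with
  | nil => rfl
  | node u l r hl hr => simp [subtreeAt, hl]

theorem subtreeAt_of_numNodes_lt (T : BinaryTree Unit) (i : ℕ) (h : T.numNodes < i) :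
    subtreeAt T i = .nil := by
  induction T generalizing i with
  | nil => rfl
  | node u l r hl hr =>
    simp only [BinaryTree.numNodes] at h
    rw [subtreeAt, if_neg (by omega), if_neg (by omega)]
    exact hr _ (by omega)

/-- The convention `β_{T,0} = 0`. -/
theorem treeVal_zero {n : ℕ} (β : Fin n → ℝ) (T : BinaryTree Unit) : treeVal β T 0 = 0 := by
  simp [treeVal, subtreeAt_zero, val]

/-- The convention `β_{T,d+1} = 0` for a tree with `d` internal vertices. -/
theorem treeVal_numNodes_add_one {n : ℕ} (β : Fin n → ℝ) (T : BinaryTree Unit) :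
    treeVal β T (T.numNodes + 1) = 0 := by
  simp [treeVal, subtreeAt_of_numNodes_lt, val]

/-! ### The nested permuto-associahedron

`Fin (d + 1)` stands for `{1, …, d+1}`, its element `i` for the number `i.val + 1`; likewise for
`Fin d`. -/

/-- The affine space of the `x ∈ ℝ^{d+1}` with `∑ x_i = ∑ α_i`. -/
def U {d : ℕ} (α : Fin (d + 1) → ℝ) : Set (Fin (d + 1) → ℝ) :=
  {x | ∑ i, x i = ∑ i, α i}

/-- The vector `f_i^π = e_{π⁻¹(i+1)} - e_{π⁻¹(i)}`. -/
def fVec {d : ℕ} (π : Equiv.Perm (Fin (d + 1))) (i : Fin d) : Fin (d + 1) → ℝ :=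
  Pi.single (π⁻¹ i.succ) 1 - Pi.single (π⁻¹ i.castSucc) 1

/-- The point `v_{π,T} = ∑_{i=1}^{d+1} α_i e_{π⁻¹(i)} + ∑_{i=1}^{d} β_{T,i} f_i^π`. -/
def vertex {d : ℕ} (α : Fin (d + 1) → ℝ) (β : Fin d → ℝ) (π : Equiv.Perm (Fin (d + 1)))
    (T : BinaryTree Unit) : Fin (d + 1) → ℝ :=
  ∑ i : Fin (d + 1), α i • (Pi.single (π⁻¹ i) 1 : Fin (d + 1) → ℝ)
    + ∑ i : Fin d, treeVal β T (i.val + 1) • fVec π i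

/-- The coefficient `α_i + (β_{T,i-1} - β_{T,i})` of `e_{π⁻¹(i)}` in `v_{π,T}`. -/
def coeff {d : ℕ} (α : Fin (d + 1) → ℝ) (β : Fin d → ℝ) (T : BinaryTree Unit)
    (i : Fin (d + 1)) : ℝ :=
  α i + (treeVal β T i.val - treeVal β T (i.val + 1))

/-- `(α, β)` is a `𝒯`-appropriate pair of strictly increasing sequences. -/
structure IsTreeAppropriate {d : ℕ} (α : Fin (d + 1) → ℝ) (β : Fin d → ℝ) : Prop where
  strictMono_left : StrictMono α
  strictMono_right : StrictMono β
  strictMono_coeff : ∀ T : BinaryTree Unit, T.numNodes = d → StrictMono (coeff α β T)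

/-- The nested permuto-associahedron `PermAsso(α, β)`. -/
def permAsso {d : ℕ} (α : Fin (d + 1) → ℝ) (β : Fin d → ℝ) : Set (Fin (d + 1) → ℝ) :=
  convexHull ℝ {v | ∃ (π : Equiv.Perm (Fin (d + 1))) (T : BinaryTree Unit),
    T.numNodes = d ∧ v = vertex α β π T}

/-! ### Ordered set partitions and the inequalities -/

/-- An ordered set partition `(S_1, …, S_k)` of an `n`-element set; `block i` is the block number
`i.val + 1`. -/
structure OrderedSetPartition (n : ℕ) where
  numBlocks : ℕ
  block : Fin numBlocks → Finset (Fin n)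
  block_nonempty : ∀ i, (block i).Nonempty
  block_disjoint : ∀ i j, i ≠ j → Disjoint (block i) (block j)
  exists_mem_block : ∀ x, ∃ i, x ∈ block i

namespace OrderedSetPartition

variable {n : ℕ} (S : OrderedSetPartition n)

/-- At least two blocks. -/
def Nontrivial : Prop := 2 ≤ S.numBlocks

/-- The entry `t_i = |S_1| + ⋯ + |S_i|` of the type, for `0 ≤ i ≤ k`. -/
def typ (i : ℕ) : ℕ := ∑ j : Fin S.numBlocks with j.val < i, (S.block j).card

/-- The vector `e_𝒮 = ∑_i i • e_{S_i}`, where `e_{S_i} = ∑_{j ∈ S_i} e_j`. -/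
def eVec : Fin n → ℝ :=
  ∑ i : Fin S.numBlocks, ((i.val : ℝ) + 1) • ∑ j ∈ S.block i, (Pi.single j 1 : Fin n → ℝ)

end OrderedSetPartition

/-- The right-hand side
`b_𝒮 = ∑_{i=1}^k i ∑_{j=t_{i-1}+1}^{t_i} α_j + (∑_{j=1}^d β_j - ∑_{i=1}^k ∑_{j=1}^{|S_i|-1} β_j)`.
The blocks are nonempty, so the subtraction `|S_i| - 1` is a true one. -/
def bound {d : ℕ} (α : Fin (d + 1) → ℝ) (β : Fin d → ℝ) (S : OrderedSetPartition (d + 1)) : ℝ :=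
  (∑ i : Fin S.numBlocks, ((i.val : ℝ) + 1) *
      ∑ j : Fin (d + 1) with S.typ i.val ≤ j.val ∧ j.val < S.typ (i.val + 1), α j)
    + (∑ j : Fin d, β j - ∑ i : Fin S.numBlocks, prefixSum β ((S.block i).card - 1))

/-- The inequality `⟨a, x⟩ ≤ b` is facet-defining on `P`: the set of points of `P` where equality
holds is a nonempty face of `P` (the set of all maximizers over `P` of some linear functional) of
dimension `dim P - 1`. The dimension of a nonempty set is that of its affine hull. -/
def IsFacetDefining {n : ℕ} (P : Set (Fin n → ℝ)) (a : Fin n → ℝ) (b : ℝ) : Prop :=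
  {x ∈ P | a ⬝ᵥ x = b}.Nonempty ∧ IsExposed ℝ P {x ∈ P | a ⬝ᵥ x = b} ∧
    Module.finrank ℝ (vectorSpan ℝ {x ∈ P | a ⬝ᵥ x = b}) + 1 = Module.finrank ℝ (vectorSpan ℝ P)

end

end NestedPermutoAssociahedron

/-! The values of a functional at the vertices separate the permutation from the tree: if `c` has
the entries `g 0, …, g d` along the list `σ 0, …, σ d`, then

  `⟨c, v_{σ⁻¹,T}⟩ = ∑ α_p g_p + ∑ β_{T,i} (g_i - g_{i-1})`.

An ordered set partition is such a list together with a set of cuts, and its `g` has the jumps `1`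
at the cuts and `0` elsewhere. The rearrangement inequality reduces the validity of `⟨e_𝒮, x⟩ ≤ b_𝒮`
to `π = σ⁻¹`, where it is the convexity of the partial sums of `β`. Equality holds for the trees in
which no cut lies below a vertex that is not a cut.

If a point `x` of `U` satisfies the inequalities, sort the entries of a functional `c` and let `T`
be heap-ordered for the jumps of `g`. The superlevel sets of the jumps are the cuts of ordered set
partitions for which `T` attains the bound, and the jumps are a nonnegative combination of the
indicators of these sets; so `⟨c, x⟩ ≤ ⟨c, v_{σ⁻¹,T}⟩`, and no functional separates `x` from
`PermAsso(α, β)`.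

On the face of `𝒮`, a constant functional `c` has equal entries on each block (exchange two elements
of a block in `σ`) and equal jumps at all cuts (rotate the tree edge that joins two cuts). So `c` is
a multiple of `e_𝒮` up to an additive constant, that is, the face is a facet. -/

namespace NestedPermutoAssociahedron

noncomputable section

/-! ### Convexity of the partial sums of a monotone sequence -/

section PrefixSum

variable {n : ℕ} {β : Fin n → ℝ}

theorem prefixSum_zero : prefixSum β 0 = 0 := by simp [prefixSum]

theorem prefixSum_eq_sum : prefixSum β n = ∑ i, β i := by simp [prefixSum]

theorem prefixSum_succ {t : ℕ} (ht : t < n) :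
    prefixSum β (t + 1) = prefixSum β t + β ⟨t, ht⟩ := by
  have hfilter : (Finset.univ.filter fun k : Fin n => k.val < t + 1) =
      insert ⟨t, ht⟩ (Finset.univ.filter fun k : Fin n => k.val < t) := by
    ext k
    simp only [Finset.mem_filter, Finset.mem_insert, Finset.mem_univ, true_and, Fin.ext_iff]
    omega
  rw [prefixSum, hfilter, Finset.sum_insert (by simp), add_comm, prefixSum]

theorem prefixSum_add_sub_le (hβ : Monotone β) {p a c : ℕ} (hpa : p ≤ a) (hac : a + c ≤ n) :
    prefixSum β (p + c) - prefixSum β p ≤ prefixSum β (a + c) - prefixSum β a := by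
  induction c with
  | zero => simp
  | succ c ih =>
    rw [← add_assoc, ← add_assoc, prefixSum_succ (by omega : p + c < n),
      prefixSum_succ (by omega : a + c < n)]
    have hlast : β ⟨p + c, by omega⟩ ≤ β ⟨a + c, by omega⟩ := hβ (Fin.mk_le_mk.2 (by omega))
    linarith [ih (by omega)]

theorem prefixSum_add_sub_lt (hβ : StrictMono β) {p a c : ℕ} (hpa : p < a) (hc : 0 < c)
    (hac : a + c ≤ n) :
    prefixSum β (p + c) - prefixSum β p < prefixSum β (a + c) - prefixSum β a := by
  obtain ⟨c, rfl⟩ := Nat.exists_eq_add_one.2 hc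
  rw [← add_assoc, ← add_assoc, prefixSum_succ (by omega : p + c < n),
    prefixSum_succ (by omega : a + c < n)]
  have hlast : β ⟨p + c, by omega⟩ < β ⟨a + c, by omega⟩ := hβ (Fin.mk_lt_mk.2 (by omega))
  linarith [prefixSum_add_sub_le hβ.monotone hpa.le (by omega : a + c ≤ n)]

end PrefixSum

/-! ### Sums over the internal vertices of a tree -/

section TreeSum

variable {n : ℕ} (β : Fin n → ℝ)

/-- The sum `∑ᵢ β_{T,i} δᵢ` over the internal vertices of `T`. As an index of `δ`, the vertex
labeled `i` has the number `i - 1`. -/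
def treeSum (T : BinaryTree Unit) (δ : ℕ → ℝ) : ℝ :=
  ∑ i ∈ Finset.range T.numNodes, treeVal β T (i + 1) * δ i

theorem treeSum_congr {T : BinaryTree Unit} {δ δ' : ℕ → ℝ} (h : ∀ i < T.numNodes, δ i = δ' i) :
    treeSum β T δ = treeSum β T δ' :=
  Finset.sum_congr rfl fun i hi => by rw [h i (Finset.mem_range.1 hi)]

theorem treeSum_zero (T : BinaryTree Unit) : treeSum β T 0 = 0 := by simp [treeSum]

theorem treeSum_node (u : Unit) (l r : BinaryTree Unit) (δ : ℕ → ℝ) :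
    treeSum β (.node u l r) δ = treeSum β l δ
      + (prefixSum β (l.numNodes + r.numNodes + 1) - prefixSum β l.numNodes
          - prefixSum β r.numNodes) * δ l.numNodes
      + treeSum β r fun i => δ (l.numNodes + 1 + i) := by
  have hleft : ∀ i < l.numNodes, treeVal β (.node u l r) (i + 1) = treeVal β l (i + 1) :=
    fun i hi => by rw [treeVal, subtreeAt, if_pos (by omega), treeVal]
  have hroot : treeVal β (.node u l r) (l.numNodes + 1) =
      prefixSum β (l.numNodes + r.numNodes + 1) - prefixSum β l.numNodes
        - prefixSum β r.numNodes := by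
    simp [treeVal, subtreeAt, val, BinaryTree.numNodes]
  have hright : ∀ i, treeVal β (.node u l r) (l.numNodes + 1 + i + 1) = treeVal β r (i + 1) :=
    fun i => by
      rw [treeVal, subtreeAt, if_neg (by omega), if_neg (by omega), treeVal]
      congr 2
      omega
  rw [treeSum, BinaryTree.numNodes, add_right_comm, Finset.sum_range_add, Finset.sum_range_succ,
    hroot, add_right_comm l.numNodes 1]
  simp only [hright]
  rw [Finset.sum_congr rfl fun i hi => by rw [hleft i (Finset.mem_range.1 hi)]]
  rfl

theorem treeSum_rotate (A C D : BinaryTree Unit) (δ : ℕ → ℝ) :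
    treeSum β (.node () A (.node () C D)) δ - treeSum β (.node () (.node () A C) D) δ =
      (δ A.numNodes - δ (A.numNodes + C.numNodes + 1)) *
        (prefixSum β (A.numNodes + C.numNodes + D.numNodes + 2)
          - prefixSum β (C.numNodes + D.numNodes + 1)
          - prefixSum β (A.numNodes + C.numNodes + 1) + prefixSum β C.numNodes) := by
  simp only [treeSum_node, BinaryTree.numNodes]
  ring_nf

end TreeSum

/-! ### Runs between cuts -/

section Runs

variable (P : ℕ → Prop) [DecidablePred P]

/-- The `0/1` labeling which is `1` where `P` holds. -/
def zeroOne (i : ℕ) : ℝ := if P i then 1 else 0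

theorem zeroOne_shift (m : ℕ) : (fun i => zeroOne P (m + i)) = zeroOne fun i => P (m + i) := rfl

/-- The length of the run of positions just before `m` at which `P` fails, where `p` further such
positions are thought to precede the position `0`. -/
def runLength (p : ℕ) : ℕ → ℕ
  | 0 => p
  | m + 1 => if P m then 0 else runLength p m + 1

theorem runLength_add (p m k : ℕ) :
    runLength P p (m + k) = runLength (fun i => P (m + i)) (runLength P p m) k := by
  induction k with
  | zero => rfl
  | succ k ih => rw [← add_assoc, runLength, runLength, ih]

theorem runLength_zero_le (m : ℕ) : runLength P 0 m ≤ m := by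
  induction m with
  | zero => rfl
  | succ m ih => rw [runLength]; split_ifs <;> omega

/-- The extra run is felt only up to the first cut. -/
theorem runLength_eq_or (p m : ℕ) :
    runLength P p m = runLength P 0 m ∨ runLength P p m = p + m ∧ runLength P 0 m = m := by
  induction m with
  | zero => exact Or.inr ⟨rfl, rfl⟩
  | succ m ih => simp only [runLength]; split_ifs <;> omega

theorem runLength_of_forall_not {P : ℕ → Prop} [DecidablePred P] {m : ℕ} (h : ∀ i < m, ¬P i) :
    runLength P 0 m = m := by
  induction m with
  | zero => rfl
  | succ m ih => rw [runLength, if_neg (h m m.lt_succ_self), ih fun i hi => h i (by omega)]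

variable {n : ℕ} (β : Fin n → ℝ)

/-- The sum of `prefixSum β` over the lengths of the maximal runs in `0, …, m - 1` at which `P`
fails, written as a sum over the positions in these runs; a first run that starts at `0` is
thought to be preceded by `p` further positions, which do not contribute. -/
def runSum (p m : ℕ) : ℝ :=
  ∑ i ∈ Finset.range m,
    if P i then 0 else prefixSum β (runLength P p i + 1) - prefixSum β (runLength P p i)

theorem runSum_zero (p : ℕ) : runSum P β p 0 = 0 := Finset.sum_range_zero _

theorem runSum_succ (p m : ℕ) :
    runSum P β p (m + 1) = runSum P β p m +
      if P m then 0 else prefixSum β (runLength P p m + 1) - prefixSum β (runLength P p m) :=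
  Finset.sum_range_succ _ _

theorem runSum_add (p m k : ℕ) :
    runSum P β p (m + k) =
      runSum P β p m + runSum (fun i => P (m + i)) β (runLength P p m) k := by
  rw [runSum, Finset.sum_range_add]
  simp only [runLength_add]
  rfl

variable {P β}

theorem runSum_of_forall_not {m : ℕ} (h : ∀ i < m, ¬P i) : runSum P β 0 m = prefixSum β m := by
  induction m with
  | zero => rw [runSum_zero, prefixSum_zero]
  | succ m ih =>
    have hm : ∀ i < m, ¬P i := fun i hi => h i (by omega)
    rw [runSum_succ, if_neg (h m m.lt_succ_self), ih hm, runLength_of_forall_not hm]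
    ring

theorem runSum_add_one_add_of_cut {m : ℕ} (h : P m) (k : ℕ) :
    runSum P β 0 (m + 1 + k) = runSum P β 0 m + runSum (fun i => P (m + 1 + i)) β 0 k := by
  rw [runSum_add, runSum_succ, runLength, if_pos h, if_pos h, add_zero]

theorem runSum_add_one_add_of_not_cut {m : ℕ} (h : ¬P m) (k : ℕ) :
    runSum P β 0 (m + 1 + k) = runSum P β 0 m
      + (prefixSum β (runLength P 0 m + 1) - prefixSum β (runLength P 0 m))
      + runSum (fun i => P (m + 1 + i)) β (runLength P 0 m + 1) k := by
  rw [runSum_add, runSum_succ, runLength, if_neg h, if_neg h]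

theorem runSum_le (hβ : Monotone β) {p m : ℕ} (hpm : p + m ≤ n) :
    runSum P β p m ≤
      runSum P β 0 m + (prefixSum β (p + m) - prefixSum β p - prefixSum β m) := by
  induction m with
  | zero => simp [runSum_zero, prefixSum_zero]
  | succ m ih =>
    have hstep := prefixSum_add_sub_le hβ (Nat.le_add_left m p) (c := 1) (by omega)
    have ih := ih (by omega)
    rw [runSum_succ, runSum_succ, ← add_assoc]
    split_ifs with h
    · linarith
    · rcases runLength_eq_or P p m with heq | ⟨hp, h0⟩
      · rw [heq]; linarith
      · rw [hp, h0]; linarith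

theorem treeSum_zeroOne_add_runSum_node_of_cut (u : Unit) {l r : BinaryTree Unit}
    (h : P l.numNodes) :
    treeSum β (.node u l r) (zeroOne P) + runSum P β 0 (BinaryTree.node u l r).numNodes =
      prefixSum β (BinaryTree.node u l r).numNodes
        + (treeSum β l (zeroOne P) + runSum P β 0 l.numNodes - prefixSum β l.numNodes)
        + (treeSum β r (zeroOne fun i => P (l.numNodes + 1 + i))
          + runSum (fun i => P (l.numNodes + 1 + i)) β 0 r.numNodes
          - prefixSum β r.numNodes) := by
  have hroot : zeroOne P l.numNodes = 1 := if_pos h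
  rw [treeSum_node, hroot, zeroOne_shift, BinaryTree.numNodes,
    add_right_comm l.numNodes r.numNodes, runSum_add_one_add_of_cut h]
  ring

theorem treeSum_zeroOne_add_runSum_le (hβ : Monotone β) {T : BinaryTree Unit}
    (hT : T.numNodes ≤ n) :
    treeSum β T (zeroOne P) + runSum P β 0 T.numNodes ≤ prefixSum β T.numNodes := by
  induction T generalizing P with
  | nil => simp [treeSum, runSum, BinaryTree.numNodes, prefixSum_zero]
  | node u l r hl hr =>
    have hn := hT
    rw [BinaryTree.numNodes] at hn
    have hleft := hl (P := P) (by omega)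
    have hright := hr (P := fun i => P (l.numNodes + 1 + i)) (by omega)
    by_cases h : P l.numNodes
    · rw [treeSum_zeroOne_add_runSum_node_of_cut u h]
      linarith
    · have hz := runLength_zero_le P l.numNodes
      have hrun := runSum_le (P := fun i => P (l.numNodes + 1 + i)) hβ
        (p := runLength P 0 l.numNodes + 1) (m := r.numNodes) (by omega)
      have hconvex := prefixSum_add_sub_le hβ hz (c := 1 + r.numNodes) (by omega)
      rw [← add_assoc, ← add_assoc] at hconvex
      have hroot : zeroOne P l.numNodes = 0 := if_neg h
      rw [treeSum_node, hroot, zeroOne_shift, BinaryTree.numNodes,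
        add_right_comm l.numNodes r.numNodes, runSum_add_one_add_of_not_cut h]
      linarith

end Runs

/-! ### Heap-ordered trees -/

section Heap

/-- `δ` is largest at the root of every subtree of `T`. -/
def IsHeap : BinaryTree Unit → (ℕ → ℝ) → Prop
  | .nil, _ => True
  | .node _ l r, δ =>
      (∀ i < l.numNodes + r.numNodes + 1, δ i ≤ δ l.numNodes) ∧ IsHeap l δ ∧
        IsHeap r fun i => δ (l.numNodes + 1 + i)

theorem IsHeap.of_le_imp_le {T : BinaryTree Unit} {δ δ' : ℕ → ℝ} (h : IsHeap T δ)
    (hδ : ∀ i j, δ i ≤ δ j → δ' i ≤ δ' j) : IsHeap T δ' := by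
  induction T generalizing δ δ' with
  | nil => trivial
  | node u l r hl hr =>
    obtain ⟨hroot, hleft, hright⟩ := h
    exact ⟨fun i hi => hδ _ _ (hroot i hi), hl hleft hδ, hr hright fun i j => hδ _ _⟩

theorem IsHeap.zeroOne_superlevel {T : BinaryTree Unit} {δ : ℕ → ℝ} (h : IsHeap T δ) (t : ℝ) :
    IsHeap T (zeroOne fun i => t ≤ δ i) :=
  h.of_le_imp_le fun i j hij => by
    unfold zeroOne
    split_ifs with hi hj
    · rfl
    · exact absurd (hi.trans hij) hj
    · exact zero_le_one
    · rfl

theorem exists_isHeap (n : ℕ) (δ : ℕ → ℝ) :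
    ∃ T : BinaryTree Unit, T.numNodes = n ∧ IsHeap T δ := by
  induction n using Nat.strong_induction_on generalizing δ with
  | _ n ih =>
    rcases Nat.eq_zero_or_pos n with rfl | hn
    · exact ⟨.nil, rfl, trivial⟩
    obtain ⟨a, ha, hmax⟩ :=
      Finset.exists_max_image (Finset.range n) δ (Finset.nonempty_range_iff.2 hn.ne')
    simp only [Finset.mem_range] at ha hmax
    obtain ⟨l, rfl, hl⟩ := ih a ha δ
    obtain ⟨r, hr, hr'⟩ := ih (n - l.numNodes - 1) (by omega) fun i => δ (l.numNodes + 1 + i)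
    exact ⟨.node () l r, by rw [BinaryTree.numNodes]; omega, fun i _ => hmax i (by omega), hl, hr'⟩

variable {P : ℕ → Prop} [DecidablePred P]

theorem IsHeap.node_of_cut {u : Unit} {l r : BinaryTree Unit} (h : P l.numNodes)
    (hl : IsHeap l (zeroOne P)) (hr : IsHeap r (zeroOne fun i => P (l.numNodes + 1 + i))) :
    IsHeap (.node u l r) (zeroOne P) :=
  ⟨fun i _ => by unfold zeroOne; split_ifs <;> norm_num, hl, hr⟩

theorem IsHeap.forall_not_of_root {u : Unit} {l r : BinaryTree Unit}
    (hheap : IsHeap (.node u l r) (zeroOne P)) (h : ¬P l.numNodes) :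
    ∀ i < (BinaryTree.node u l r).numNodes, ¬P i := fun i hi hPi => by
  have hle := hheap.1 i hi
  rw [zeroOne, zeroOne, if_pos hPi, if_neg h] at hle
  exact absurd hle (by norm_num)

theorem IsHeap.treeSum_zeroOne_add_runSum {n : ℕ} {β : Fin n → ℝ} {T : BinaryTree Unit}
    (hheap : IsHeap T (zeroOne P)) :
    treeSum β T (zeroOne P) + runSum P β 0 T.numNodes = prefixSum β T.numNodes := by
  induction T generalizing P with
  | nil => simp [treeSum, runSum, BinaryTree.numNodes, prefixSum_zero]
  | node u l r hl hr =>
    by_cases h : P l.numNodes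
    · have hright := hr (P := fun i => P (l.numNodes + 1 + i)) hheap.2.2
      rw [treeSum_zeroOne_add_runSum_node_of_cut u h, hl hheap.2.1, hright]
      ring
    · have hnot := hheap.forall_not_of_root h
      have hzero : ∀ i < (BinaryTree.node u l r).numNodes, zeroOne P i = (0 : ℕ → ℝ) i :=
        fun i hi => if_neg (hnot i hi)
      rw [runSum_of_forall_not hnot, treeSum_congr β hzero, treeSum_zero, zero_add]

/-- The two trees differ by a rotation of the edge between the vertices `i` and `j`. -/
theorem exists_isHeap_rotate {d : ℕ} {β : Fin d → ℝ} (hβ : StrictMono β) {i j : ℕ} (hij : i < j)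
    (hjd : j < d) (hi : P i) (hj : P j) :
    ∃ T₁ T₂ : BinaryTree Unit, T₁.numNodes = d ∧ T₂.numNodes = d ∧ IsHeap T₁ (zeroOne P) ∧
      IsHeap T₂ (zeroOne P) ∧
      ∃ κ ≠ 0, ∀ δ, treeSum β T₁ δ - treeSum β T₂ δ = (δ i - δ j) * κ := by
  obtain ⟨A, rfl, hA⟩ := exists_isHeap i (zeroOne P)
  obtain ⟨C, hC, hC'⟩ := exists_isHeap (j - A.numNodes - 1)
    (zeroOne fun k => P (A.numNodes + 1 + k))
  obtain ⟨D, hD, hD'⟩ := exists_isHeap (d - j - 1) (zeroOne fun k => P (j + 1 + k))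
  obtain rfl : A.numNodes + C.numNodes + 1 = j := by omega
  obtain rfl : A.numNodes + C.numNodes + D.numNodes + 2 = d := by omega
  refine ⟨.node () A (.node () C D), .node () (.node () A C) D, ?_, ?_,
    hA.node_of_cut hi (hC'.node_of_cut ?_ ?_), (hA.node_of_cut hi hC').node_of_cut hj hD',
    _, ne_of_gt ?_, treeSum_rotate β A C D⟩
  · simp only [BinaryTree.numNodes]; omega
  · simp only [BinaryTree.numNodes]; omega
  · rwa [add_right_comm]
  · convert hD' using 4
    omega
  · have hlt := prefixSum_add_sub_lt hβ (p := C.numNodes) (a := C.numNodes + D.numNodes + 1)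
      (c := A.numNodes + 1) (by omega) (by omega) (by omega)
    have e₁ : C.numNodes + (A.numNodes + 1) = A.numNodes + C.numNodes + 1 := by omega
    have e₂ : C.numNodes + D.numNodes + 1 + (A.numNodes + 1) =
      A.numNodes + C.numNodes + D.numNodes + 2 := by omega
    rw [e₁, e₂] at hlt
    linarith

end Heap

/-! ### Ordered set partitions from cuts -/

theorem clamp_val {n : ℕ} (p : Fin (n + 1)) : Fin.clamp p n = p :=
  Fin.ext (min_eq_left p.is_le)

section Count

variable {P : ℕ → Prop} [DecidablePred P]

theorem exists_count_eq_of_le {i n : ℕ} (h : i ≤ Nat.count P n) :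
    ∃ p ≤ n, Nat.count P p = i := by
  induction n with
  | zero => exact ⟨0, le_rfl, by rw [Nat.count_zero] at h ⊢; omega⟩
  | succ n ih =>
    rcases h.eq_or_lt with rfl | hlt
    · exact ⟨n + 1, le_rfl, rfl⟩
    · rw [Nat.count_succ] at hlt
      obtain ⟨p, hp, hpi⟩ := ih (by split_ifs at hlt <;> omega)
      exact ⟨p, hp.trans n.le_succ, hpi⟩

theorem count_ne_add_one_eq {f : ℕ → ℕ} (hf : Monotone f) (hrange : IsLowerSet (Set.range f))
    (p : ℕ) : Nat.count (fun i => f i ≠ f (i + 1)) p = f p := by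
  induction p with
  | zero =>
    obtain ⟨q, hq⟩ := hrange (Nat.zero_le (f 0)) ⟨0, rfl⟩
    have hle := hf (Nat.zero_le q)
    rw [Nat.count_zero]
    omega
  | succ p ih =>
    have hle : f p ≤ f (p + 1) := hf p.le_succ
    rw [Nat.count_succ, ih]
    split_ifs with hne
    · obtain ⟨q, hq⟩ : f p + 1 ∈ Set.range f := hrange (lt_of_le_of_ne hle hne) ⟨p + 1, rfl⟩
      have hpq : p < q := hf.reflect_lt (by omega)
      have hle' : f (p + 1) ≤ f q := hf hpq
      omega
    · omega

theorem count_count_self (m : ℕ) :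
    Nat.count (fun p => Nat.count P p = Nat.count P m) (m + 1) = runLength P 0 m + 1 := by
  induction m with
  | zero => rfl
  | succ m ih =>
    rw [Nat.count_succ, if_pos rfl, runLength]
    by_cases h : P m
    · have hcount : Nat.count P (m + 1) = Nat.count P m + 1 := by simp [Nat.count_succ, h]
      rw [if_pos h, hcount, Nat.add_eq_right]
      refine Nat.count_iff_forall_not.2 fun p hp => ?_
      have hle := Nat.count_monotone P (Nat.lt_succ_iff.1 hp)
      omega
    · have hcount : Nat.count P (m + 1) = Nat.count P m := by simp [Nat.count_succ, h]
      rw [if_neg h, hcount, ih]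

theorem sum_prefixSum_count_sub_one {n : ℕ} (β : Fin n → ℝ) (m : ℕ) :
    ∑ i ∈ Finset.range (Nat.count P m + 1),
      prefixSum β (Nat.count (fun p => Nat.count P p = i) (m + 1) - 1) = runSum P β 0 m := by
  induction m with
  | zero => simp [runSum_zero, Nat.count_succ, prefixSum_zero]
  | succ m ih =>
    have hlower : ∀ i < Nat.count P (m + 1),
        Nat.count (fun p => Nat.count P p = i) (m + 1 + 1) =
          Nat.count (fun p => Nat.count P p = i) (m + 1) := fun i hi => by
      rw [Nat.count_succ, if_neg hi.ne', add_zero]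
    rw [Finset.sum_range_succ, count_count_self, Nat.add_sub_cancel,
      Finset.sum_congr rfl fun i hi => by rw [hlower i (Finset.mem_range.1 hi)], runSum_succ,
      ← ih, runLength, Nat.count_succ]
    split_ifs with h
    · rw [prefixSum_zero]
    · rw [add_zero, Finset.sum_range_succ, count_count_self, Nat.add_sub_cancel]
      ring

end Count

namespace OrderedSetPartition

section BlockIndex

variable {n : ℕ} {S S' : OrderedSetPartition n} {f : Fin n → ℕ}

theorem numBlocks_le_of_mem_block_iff (hS : ∀ i x, x ∈ S.block i ↔ f x = i)
    (hS' : ∀ i x, x ∈ S'.block i ↔ f x = i) : S.numBlocks ≤ S'.numBlocks := by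
  by_contra! hlt
  obtain ⟨x, hx⟩ := S.block_nonempty ⟨S'.numBlocks, hlt⟩
  obtain ⟨j, hj⟩ := S'.exists_mem_block x
  exact j.2.ne' (((hS _ x).1 hx).symm.trans ((hS' j x).1 hj))

theorem eq_of_mem_block_iff (hS : ∀ i x, x ∈ S.block i ↔ f x = i)
    (hS' : ∀ i x, x ∈ S'.block i ↔ f x = i) : S = S' := by
  have hle := numBlocks_le_of_mem_block_iff hS hS'
  have hge := numBlocks_le_of_mem_block_iff hS' hS
  obtain ⟨k, block, _, _, _⟩ := S
  obtain ⟨k', block', _, _, _⟩ := S'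
  obtain rfl : k = k' := hle.antisymm hge
  congr 1
  ext i x
  rw [hS, hS']

theorem exists_mem_block_iff (S : OrderedSetPartition n) :
    ∃ f : Fin n → ℕ, ∀ i x, x ∈ S.block i ↔ f x = i := by
  choose idx hidx using S.exists_mem_block
  refine ⟨fun x => idx x, fun i x => ⟨fun hx => ?_, fun hx => Fin.ext hx ▸ hidx x⟩⟩
  by_contra hne
  exact Finset.disjoint_left.1 (S.block_disjoint _ _ (Fin.val_ne_iff.1 hne)) (hidx x) hx

end BlockIndex

variable {d : ℕ} (σ : Equiv.Perm (Fin (d + 1))) (P : ℕ → Prop) [DecidablePred P]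

/-- The ordered set partition obtained by cutting the list `σ 0, …, σ d` between its entries `i`
and `i + 1` whenever `P i` holds. -/
def ofCuts : OrderedSetPartition (d + 1) where
  numBlocks := Nat.count P d + 1
  block i := {x | Nat.count P (σ.symm x) = i}
  block_nonempty i := by
    obtain ⟨p, hp, hpi⟩ := exists_count_eq_of_le (Nat.lt_succ_iff.1 i.2)
    exact ⟨σ ⟨p, by omega⟩, by simpa using hpi⟩
  block_disjoint i j hij := Finset.disjoint_left.2 fun x hi hj => hij <| Fin.ext <|
    (Finset.mem_filter.1 hi).2.symm.trans (Finset.mem_filter.1 hj).2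
  exists_mem_block x :=
    ⟨⟨Nat.count P (σ.symm x), Nat.lt_succ_iff.2 (Nat.count_monotone P (by omega))⟩, by simp⟩

theorem mem_block_ofCuts (i : Fin (ofCuts σ P).numBlocks) (x : Fin (d + 1)) :
    x ∈ (ofCuts σ P).block i ↔ Nat.count P (σ.symm x) = i := by
  simp [ofCuts]

theorem exists_eq_ofCuts (S : OrderedSetPartition (d + 1)) :
    ∃ (σ : Equiv.Perm (Fin (d + 1))) (P : ℕ → Prop) (_ : DecidablePred P), S = ofCuts σ P := by
  obtain ⟨idx, hidx⟩ := S.exists_mem_block_iff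
  let σ := Tuple.sort idx
  let f : ℕ → ℕ := fun p => idx (σ (Fin.clamp p d))
  have hf : Monotone f := fun p q hpq =>
    Tuple.monotone_sort idx (Fin.clamp_monotone hpq)
  have hf_inv : ∀ x, f (σ.symm x) = idx x := fun x => by
    simp only [f, clamp_val, Equiv.apply_symm_apply]
  have hrange : IsLowerSet (Set.range f) := by
    rintro _ j hj ⟨p, rfl⟩
    obtain ⟨i, hi⟩ := S.exists_mem_block (σ (Fin.clamp p d))
    obtain ⟨x, hx⟩ := S.block_nonempty ⟨j, hj.trans_lt (((hidx _ _).1 hi).trans_lt i.2)⟩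
    exact ⟨σ.symm x, (hf_inv x).trans ((hidx _ _).1 hx)⟩
  refine ⟨σ, fun i => f i ≠ f (i + 1), inferInstance, eq_of_mem_block_iff hidx fun i x => ?_⟩
  rw [mem_block_ofCuts, count_ne_add_one_eq hf hrange, hf_inv]

variable {P}

theorem ofCuts_swap_mul {p q : Fin (d + 1)} (h : Nat.count P p = Nat.count P q) :
    ofCuts (Equiv.swap (σ p) (σ q) * σ) P = ofCuts σ P := by
  refine eq_of_mem_block_iff (mem_block_ofCuts _ P) fun i x => ?_
  rw [mem_block_ofCuts, Equiv.Perm.mul_def, Equiv.symm_trans_apply, Equiv.symm_swap]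
  rcases eq_or_ne x (σ p) with rfl | hp
  · simp [h]
  rcases eq_or_ne x (σ q) with rfl | hq
  · simp [h]
  · rw [Equiv.swap_apply_of_ne_of_ne hp hq]

variable {σ}

theorem exists_cut_of_nontrivial (h : (ofCuts σ P).Nontrivial) : ∃ i < d, P i := by
  by_contra! hP
  have hcount : Nat.count P d = 0 := Nat.count_iff_forall_not.2 hP
  have hblocks : 2 ≤ Nat.count P d + 1 := h
  omega

variable (σ P)

theorem eVec_ofCuts_apply (p : Fin (d + 1)) :
    (ofCuts σ P).eVec (σ p) = Nat.count P p + 1 := by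
  obtain ⟨i, hi⟩ := (ofCuts σ P).exists_mem_block (σ p)
  have hblock : ∀ j, σ p ∈ (ofCuts σ P).block j ↔ i = j := fun j => by
    rw [mem_block_ofCuts] at hi ⊢
    rw [hi, Fin.ext_iff]
  rw [mem_block_ofCuts, Equiv.symm_apply_apply] at hi
  rw [hi]
  simp [eVec, Finset.sum_apply, Pi.single_apply, hblock]

theorem card_block_ofCuts (i : Fin (ofCuts σ P).numBlocks) :
    ((ofCuts σ P).block i).card = Nat.count (fun p => Nat.count P p = i) (d + 1) := by
  rw [Nat.count_eq_card_filter_range, Finset.card_filter,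
    ← Fin.sum_univ_eq_sum_range (fun p => if Nat.count P p = i then 1 else 0),
    ← Equiv.sum_comp σ.symm, ← Finset.card_filter]
  rfl

theorem typ_ofCuts (i : ℕ) :
    (ofCuts σ P).typ i = (Finset.univ.filter fun p : Fin (d + 1) => Nat.count P p < i).card := by
  rw [typ, ← Finset.card_biUnion fun j _ k _ => (ofCuts σ P).block_disjoint j k]
  refine Finset.card_equiv σ.symm fun x => ?_
  obtain ⟨k, hk⟩ := (ofCuts σ P).exists_mem_block x
  simp only [Finset.mem_biUnion, Finset.mem_filter, Finset.mem_univ, true_and,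
    mem_block_ofCuts] at hk ⊢
  exact ⟨fun ⟨_, hj, hxj⟩ => hxj ▸ hj, fun h => ⟨k, hk ▸ h, hk⟩⟩

theorem lt_typ_ofCuts_iff (i : ℕ) (p : Fin (d + 1)) :
    (p : ℕ) < (ofCuts σ P).typ i ↔ Nat.count P p < i := by
  rw [typ_ofCuts]
  exact Tuple.lt_card_lt_iff_apply_lt_of_monotone (f := fun p : Fin (d + 1) => Nat.count P p)
    fun _ _ hpq => Nat.count_monotone P hpq

theorem bound_ofCuts (α : Fin (d + 1) → ℝ) (β : Fin d → ℝ) :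
    bound α β (ofCuts σ P) =
      ∑ p : Fin (d + 1), α p * (Nat.count P p + 1) + (prefixSum β d - runSum P β 0 d) := by
  have hlevel : ∀ i, (Finset.univ.filter fun p : Fin (d + 1) =>
      (ofCuts σ P).typ i ≤ p ∧ (p : ℕ) < (ofCuts σ P).typ (i + 1)) =
        Finset.univ.filter fun p : Fin (d + 1) => Nat.count P p = i := fun i => by
    ext p
    have hlow := lt_typ_ofCuts_iff σ P i p
    have hhigh := lt_typ_ofCuts_iff σ P (i + 1) p
    simp only [Finset.mem_filter, Finset.mem_univ, true_and]
    omega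
  rw [bound, prefixSum_eq_sum]
  congr 1
  · rw [← Finset.sum_fiberwise Finset.univ fun p : Fin (d + 1) => (⟨Nat.count P p,
      Nat.lt_succ_iff.2 (Nat.count_monotone P (by omega))⟩ : Fin (ofCuts σ P).numBlocks)]
    refine Finset.sum_congr rfl fun i _ => ?_
    rw [hlevel, Finset.mul_sum]
    refine Finset.sum_congr (by simp only [Fin.ext_iff]) fun p hp => ?_
    obtain rfl := (Finset.mem_filter.1 hp).2
    exact mul_comm _ _
  · simp only [card_block_ofCuts]
    congr 1
    exact (Fin.sum_univ_eq_sum_range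
      (fun i => prefixSum β (Nat.count (fun p => Nat.count P p = i) (d + 1) - 1)) _).trans
      (sum_prefixSum_count_sub_one β d)

end OrderedSetPartition

/-! ### Vertices and linear functionals -/

section Vertices

variable {d : ℕ} {α : Fin (d + 1) → ℝ} {β : Fin d → ℝ}

theorem sum_mul_succ_sub_castSucc {t : ℕ → ℝ} (h₀ : t 0 = 0) (hd : t (d + 1) = 0)
    (e : Fin (d + 1) → ℝ) :
    ∑ i : Fin d, t (i + 1) * (e i.succ - e i.castSucc) =
      ∑ i : Fin (d + 1), (t i - t (i + 1)) * e i := by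
  simp only [mul_sub, sub_mul, Finset.sum_sub_distrib]
  rw [Fin.sum_univ_succ (fun i : Fin (d + 1) => t i * e i),
    Fin.sum_univ_castSucc (fun i : Fin (d + 1) => t (i + 1) * e i)]
  simp [h₀, hd]

theorem vertex_apply (π : Equiv.Perm (Fin (d + 1))) {T : BinaryTree Unit} (hT : T.numNodes = d)
    (x : Fin (d + 1)) : vertex α β π T x = coeff α β T (π x) := by
  have hsingle : ∀ i, (Pi.single (π⁻¹ i) 1 : Fin (d + 1) → ℝ) x = if i = π x then 1 else 0 :=
    fun i => by
      rw [Pi.single_apply]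
      exact if_congr (by rw [Equiv.Perm.eq_inv_iff_eq, eq_comm]) rfl rfl
  simp only [vertex, fVec, Pi.add_apply, Finset.sum_apply, Pi.smul_apply, Pi.sub_apply, hsingle,
    smul_eq_mul]
  rw [sum_mul_succ_sub_castSucc (treeVal_zero β T) (hT ▸ treeVal_numNodes_add_one β T)
    fun i => if i = π x then 1 else 0]
  simp [coeff]

theorem sum_coeff_mul {T : BinaryTree Unit} (hT : T.numNodes = d) (g : ℕ → ℝ) :
    ∑ p, coeff α β T p * g p =
      ∑ p : Fin (d + 1), α p * g p + treeSum β T fun i => g (i + 1) - g i := by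
  simp only [coeff, add_mul, Finset.sum_add_distrib]
  rw [← sum_mul_succ_sub_castSucc (treeVal_zero β T) (hT ▸ treeVal_numNodes_add_one β T)
    fun i => g i, treeSum, hT,
    ← Fin.sum_univ_eq_sum_range fun i => treeVal β T (i + 1) * (g (i + 1) - g i)]
  simp only [Fin.val_succ, Fin.val_castSucc]

theorem dotProduct_vertex (c : Fin (d + 1) → ℝ) (π : Equiv.Perm (Fin (d + 1)))
    {T : BinaryTree Unit} (hT : T.numNodes = d) :
    c ⬝ᵥ vertex α β π T = ∑ p, coeff α β T p * c (π⁻¹ p) := by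
  rw [dotProduct, ← Equiv.sum_comp π⁻¹]
  simp [vertex_apply π hT, mul_comm]

theorem dotProduct_vertex_inv {c : Fin (d + 1) → ℝ} {σ : Equiv.Perm (Fin (d + 1))} {g : ℕ → ℝ}
    (hg : ∀ p : Fin (d + 1), c (σ p) = g p) {T : BinaryTree Unit} (hT : T.numNodes = d) :
    c ⬝ᵥ vertex α β σ⁻¹ T =
      ∑ p : Fin (d + 1), α p * g p + treeSum β T fun i => g (i + 1) - g i := by
  rw [dotProduct_vertex c σ⁻¹ hT, inv_inv, ← sum_coeff_mul hT]
  simp only [hg]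

theorem vertex_mem_permAsso (π : Equiv.Perm (Fin (d + 1))) {T : BinaryTree Unit}
    (hT : T.numNodes = d) : vertex α β π T ∈ permAsso α β :=
  subset_convexHull ℝ _ ⟨π, T, hT, rfl⟩

theorem permAsso_subset_U : permAsso α β ⊆ U α := by
  refine convexHull_min ?_ (convex_hyperplane (f := fun x : Fin (d + 1) → ℝ => ∑ i, x i)
    ⟨fun x y => Finset.sum_add_distrib, fun r x => (Finset.mul_sum ..).symm⟩ _)
  rintro _ ⟨π, T, hT, rfl⟩
  have hsum := sum_coeff_mul (α := α) (β := β) hT 1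
  simp only [Pi.one_apply, mul_one, sub_self] at hsum
  simp only [U, Set.mem_ofPred_eq, vertex_apply π hT]
  rw [Equiv.sum_comp π, hsum, ← Pi.zero_def, treeSum_zero, add_zero]

theorem finite_setOf_vertex (α : Fin (d + 1) → ℝ) (β : Fin d → ℝ) :
    {v | ∃ (π : Equiv.Perm (Fin (d + 1))) (T : BinaryTree Unit),
      T.numNodes = d ∧ v = vertex α β π T}.Finite := by
  refine ((Set.finite_univ (α := Equiv.Perm (Fin (d + 1)))).prod
    (BinaryTree.treesOfNumNodesEq d).finite_toSet).image
    (fun q => vertex α β q.1 q.2) |>.subset ?_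
  rintro _ ⟨π, T, hT, rfl⟩
  exact ⟨(π, T), ⟨Set.mem_univ _, BinaryTree.mem_treesOfNumNodesEq.2 hT⟩, rfl⟩

end Vertices

/-! ### The inequalities on the vertices -/

section Inequalities

variable {d : ℕ} {α : Fin (d + 1) → ℝ} {β : Fin d → ℝ} {σ : Equiv.Perm (Fin (d + 1))}
  {P : ℕ → Prop} [DecidablePred P]

theorem count_add_one_sub_count (i : ℕ) :
    ((Nat.count P (i + 1) : ℝ) + 1) - (Nat.count P i + 1) = zeroOne P i := by
  rw [Nat.count_succ, zeroOne]
  split_ifs <;> simp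

theorem eVec_dotProduct_vertex_inv {T : BinaryTree Unit} (hT : T.numNodes = d) :
    (OrderedSetPartition.ofCuts σ P).eVec ⬝ᵥ vertex α β σ⁻¹ T =
      ∑ p : Fin (d + 1), α p * (Nat.count P p + 1) + treeSum β T (zeroOne P) := by
  rw [dotProduct_vertex_inv (OrderedSetPartition.eVec_ofCuts_apply σ P) hT
    (g := fun p => (Nat.count P p : ℝ) + 1)]
  simp only [count_add_one_sub_count]

theorem eVec_dotProduct_vertex_le_inv {T : BinaryTree Unit} (hT : T.numNodes = d)
    (hcoeff : Monotone (coeff α β T)) (π : Equiv.Perm (Fin (d + 1))) :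
    (OrderedSetPartition.ofCuts σ P).eVec ⬝ᵥ vertex α β π T ≤
      (OrderedSetPartition.ofCuts σ P).eVec ⬝ᵥ vertex α β σ⁻¹ T := by
  have hmono : Monotone fun p => (OrderedSetPartition.ofCuts σ P).eVec (σ p) := fun p q hpq => by
    simp only [OrderedSetPartition.eVec_ofCuts_apply]
    exact add_le_add_left (Nat.cast_le.2 (Nat.count_monotone P hpq)) 1
  have hrearrange :=
    (hcoeff.monovary hmono).sum_mul_comp_perm_le_sum_mul (σ := σ⁻¹ * π⁻¹)
  simpa [dotProduct_vertex _ _ hT] using hrearrange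

theorem eVec_dotProduct_vertex_le_bound (hβ : Monotone β) {T : BinaryTree Unit}
    (hT : T.numNodes = d) (hcoeff : Monotone (coeff α β T)) (π : Equiv.Perm (Fin (d + 1))) :
    (OrderedSetPartition.ofCuts σ P).eVec ⬝ᵥ vertex α β π T ≤
      bound α β (OrderedSetPartition.ofCuts σ P) := by
  refine (eVec_dotProduct_vertex_le_inv hT hcoeff π).trans ?_
  have htree := treeSum_zeroOne_add_runSum_le (P := P) hβ hT.le
  rw [hT] at htree
  rw [eVec_dotProduct_vertex_inv hT, OrderedSetPartition.bound_ofCuts]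
  linarith

theorem IsHeap.eVec_dotProduct_vertex_eq_bound {T : BinaryTree Unit}
    (hheap : IsHeap T (zeroOne P)) (hT : T.numNodes = d) :
    (OrderedSetPartition.ofCuts σ P).eVec ⬝ᵥ vertex α β σ⁻¹ T =
      bound α β (OrderedSetPartition.ofCuts σ P) := by
  have htree := hheap.treeSum_zeroOne_add_runSum (β := β)
  rw [hT] at htree
  rw [eVec_dotProduct_vertex_inv hT, OrderedSetPartition.bound_ofCuts]
  linarith

theorem eVec_dotProduct_le_bound (hβ : Monotone β)
    (hcoeff : ∀ T : BinaryTree Unit, T.numNodes = d → Monotone (coeff α β T))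
    (S : OrderedSetPartition (d + 1)) {x : Fin (d + 1) → ℝ} (hx : x ∈ permAsso α β) :
    S.eVec ⬝ᵥ x ≤ bound α β S := by
  obtain ⟨σ, P, _, rfl⟩ := S.exists_eq_ofCuts
  refine convexHull_min ?_ (convex_halfSpace_le
    ⟨dotProduct_add _, fun a x => dotProduct_smul a _ x⟩ (bound α β _)) hx
  rintro _ ⟨π, T, hT, rfl⟩
  exact eVec_dotProduct_vertex_le_bound hβ hT (hcoeff T hT) π

end Inequalities

/-! ### The inequalities cut out the polytope -/

section Separation

/-- Layer cake: a nonnegative function is the integral of the indicators of its superlevel sets. -/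
theorem sum_mul_nonneg_of_superlevel {ι : Type*} {s : Finset ι} {k δ : ι → ℝ}
    (hδ : ∀ i ∈ s, 0 ≤ δ i) (h : ∀ t, 0 ≤ ∑ i ∈ s, k i * if t ≤ δ i then 1 else 0) :
    0 ≤ ∑ i ∈ s, k i * δ i := by
  have hint : ∀ i, IntervalIntegrable (fun t => if t ≤ δ i then (1 : ℝ) else 0)
      MeasureTheory.volume 0 (∑ i ∈ s, δ i) := fun i =>
    Antitone.intervalIntegrable fun t t' htt' => by
      split_ifs <;> linarith
  have hlayer : ∀ i ∈ s, ∫ t in 0..∑ i ∈ s, δ i, (if t ≤ δ i then (1 : ℝ) else 0) = δ i :=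
    fun i hi => by
      have hind := intervalIntegral.integral_indicator (f := fun _ => (1 : ℝ))
        (μ := MeasureTheory.volume) ⟨hδ i hi, Finset.single_le_sum hδ hi⟩
      simpa [Set.indicator_apply] using hind
  calc
    0 ≤ ∫ t in 0..∑ i ∈ s, δ i, ∑ i ∈ s, k i * if t ≤ δ i then 1 else 0 :=
      intervalIntegral.integral_nonneg (Finset.sum_nonneg hδ) fun t _ => h t
    _ = ∑ i ∈ s, k i * ∫ t in 0..∑ i ∈ s, δ i, if t ≤ δ i then 1 else 0 := by
      rw [intervalIntegral.integral_finsetSum fun i _ => (hint i).const_mul (k i)]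
      simp only [intervalIntegral.integral_const_mul]
    _ = ∑ i ∈ s, k i * δ i := Finset.sum_congr rfl fun i hi => by rw [hlayer i hi]

theorem sum_range_zeroOne (P : ℕ → Prop) [DecidablePred P] (m : ℕ) :
    ∑ i ∈ Finset.range m, zeroOne P i = Nat.count P m := by
  rw [Nat.count_eq_card_filter_range, ← Finset.sum_boole]
  rfl

variable {d : ℕ} {α : Fin (d + 1) → ℝ} {β : Fin d → ℝ} {x : Fin (d + 1) → ℝ}

theorem sum_sub_mul_sub_of_mem_U (hx : x ∈ U α) (σ : Equiv.Perm (Fin (d + 1)))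
    (g : Fin (d + 1) → ℝ) (r : ℝ) :
    ∑ p, (x (σ p) - α p) * (g p - r) = ∑ p, g p * x (σ p) - ∑ p, α p * g p := by
  have hsum : ∑ p, x (σ p) = ∑ p, α p := (Equiv.sum_comp σ x).trans hx
  have hzero : ∑ p, (x (σ p) - α p) * r = 0 := by
    rw [← Finset.sum_mul, Finset.sum_sub_distrib, hsum, sub_self, zero_mul]
  simp only [mul_sub, Finset.sum_sub_distrib, sub_mul, mul_comm (g _)] at hzero ⊢
  rw [hzero, sub_zero]

theorem IsHeap.sum_sub_mul_count_le {P : ℕ → Prop} [DecidablePred P] {T : BinaryTree Unit}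
    (hheap : IsHeap T (zeroOne P)) (hT : T.numNodes = d) (hxU : x ∈ U α)
    (hx : ∀ S : OrderedSetPartition (d + 1), S.Nontrivial → S.eVec ⬝ᵥ x ≤ bound α β S)
    (σ : Equiv.Perm (Fin (d + 1))) :
    ∑ p : Fin (d + 1), (x (σ p) - α p) * Nat.count P p ≤ treeSum β T (zeroOne P) := by
  rcases Nat.eq_zero_or_pos (Nat.count P d) with hcount | hcount
  · have hnot : ∀ i < d, ¬P i := Nat.count_iff_forall_not.1 hcount
    have hcount' : ∀ p : Fin (d + 1), Nat.count P p = 0 := fun p =>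
      Nat.count_iff_forall_not.2 fun i hi => hnot i (by omega)
    have hzero : ∀ i < T.numNodes, zeroOne P i = (0 : ℕ → ℝ) i :=
      fun i hi => if_neg (hnot i (hT ▸ hi))
    simp [treeSum_congr β hzero, treeSum_zero, hcount']
  · have hineq := hx (OrderedSetPartition.ofCuts σ P) (Nat.succ_le_succ hcount)
    rw [← hheap.eVec_dotProduct_vertex_eq_bound hT, eVec_dotProduct_vertex_inv hT, dotProduct,
      ← Equiv.sum_comp σ] at hineq
    have hsum := sum_sub_mul_sub_of_mem_U hxU σ (fun p => (Nat.count P p : ℝ) + 1) 1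
    simp only [OrderedSetPartition.eVec_ofCuts_apply, add_sub_cancel_right] at hineq hsum
    linarith

theorem sum_mul_sum_range (y : Fin (d + 1) → ℝ) (δ : ℕ → ℝ) :
    ∑ p, y p * ∑ i ∈ Finset.range p, δ i =
      ∑ i ∈ Finset.range d, (∑ p : Fin (d + 1) with i < p.val, y p) * δ i := by
  simp only [Finset.mul_sum, Finset.sum_mul]
  exact Finset.sum_comm' fun p i => by simp; omega

theorem IsHeap.sum_sub_mul_sum_range_le {T : BinaryTree Unit} {δ : ℕ → ℝ} (hheap : IsHeap T δ)
    (hδ : ∀ i, 0 ≤ δ i) (hT : T.numNodes = d) (hxU : x ∈ U α)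
    (hx : ∀ S : OrderedSetPartition (d + 1), S.Nontrivial → S.eVec ⬝ᵥ x ≤ bound α β S)
    (σ : Equiv.Perm (Fin (d + 1))) :
    ∑ p : Fin (d + 1), (x (σ p) - α p) * ∑ i ∈ Finset.range p, δ i ≤ treeSum β T δ := by
  have hlinear : ∀ δ : ℕ → ℝ,
      treeSum β T δ - ∑ p : Fin (d + 1), (x (σ p) - α p) * ∑ i ∈ Finset.range p, δ i =
        ∑ i ∈ Finset.range d, (treeVal β T (i + 1)
          - ∑ p : Fin (d + 1) with i < p.val, (x (σ p) - α p)) * δ i := fun δ => by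
    rw [sum_mul_sum_range, treeSum, hT, ← Finset.sum_sub_distrib]
    simp only [sub_mul]
  rw [← sub_nonneg, hlinear]
  refine sum_mul_nonneg_of_superlevel (fun i _ => hδ i) fun t => ?_
  have hlevel := (hheap.zeroOne_superlevel t).sum_sub_mul_count_le (β := β) hT hxU hx σ
  simp only [← sum_range_zeroOne] at hlevel
  rw [← sub_nonneg, hlinear] at hlevel
  exact hlevel

theorem mem_permAsso_of_forall_le (hxU : x ∈ U α)
    (hx : ∀ S : OrderedSetPartition (d + 1), S.Nontrivial → S.eVec ⬝ᵥ x ≤ bound α β S) :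
    x ∈ permAsso α β := by
  by_contra hxP
  obtain ⟨f, u, hfu, hux⟩ := geometric_hahn_banach_closed_point (convex_convexHull ℝ _)
    ((finite_setOf_vertex α β).isClosed_convexHull ℝ) hxP
  obtain ⟨c, hc⟩ := (dotProductEquiv ℝ (Fin (d + 1))).surjective f.toLinearMap
  have hf : ∀ y, f y = c ⬝ᵥ y := fun y => (LinearMap.congr_fun hc y).symm
  let σ := Tuple.sort c
  let g : ℕ → ℝ := fun p => c (σ (Fin.clamp p d))
  have hg : Monotone g := fun p q hpq =>
    Tuple.monotone_sort c (Fin.clamp_monotone hpq)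
  have hcg : ∀ p : Fin (d + 1), c (σ p) = g p := fun p => by simp only [g, clamp_val]
  obtain ⟨T, hT, hheap⟩ := exists_isHeap d fun i => g (i + 1) - g i
  have hle := hheap.sum_sub_mul_sum_range_le (β := β) (fun i => sub_nonneg.2 (hg i.le_succ)) hT
    hxU hx σ
  simp only [Finset.sum_range_sub] at hle
  rw [sum_sub_mul_sub_of_mem_U hxU σ (fun p => g p)] at hle
  have hvertex : f (vertex α β σ⁻¹ T) < u := hfu _ (vertex_mem_permAsso σ⁻¹ hT)
  rw [hf, dotProduct_vertex_inv hcg hT] at hvertex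
  rw [hf, dotProduct, ← Equiv.sum_comp σ] at hux
  simp only [hcg] at hux
  linarith

theorem permAsso_eq (hβ : Monotone β)
    (hcoeff : ∀ T : BinaryTree Unit, T.numNodes = d → Monotone (coeff α β T)) :
    permAsso α β = {x ∈ U α | ∀ S : OrderedSetPartition (d + 1), S.Nontrivial →
      S.eVec ⬝ᵥ x ≤ bound α β S} :=
  Set.Subset.antisymm
    (fun _ hx => ⟨permAsso_subset_U hx, fun S _ => eVec_dotProduct_le_bound hβ hcoeff S hx⟩)
    fun _ hx => mem_permAsso_of_forall_le hx.1 hx.2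

end Separation

/-! ### Facets -/

section Codimension

variable {K E : Type*} [Field K] [AddCommGroup E] [Module K E] {s t : Set E}

theorem mem_dualAnnihilator_vectorSpan_iff {f : Module.Dual K E} :
    f ∈ (vectorSpan K s).dualAnnihilator ↔ ∀ x ∈ s, ∀ y ∈ s, f x = f y := by
  rw [Submodule.mem_dualAnnihilator]
  refine ⟨fun h x hx y hy => ?_, fun h v hv => ?_⟩
  · rw [← sub_eq_zero, ← map_sub]
    exact h _ (vsub_mem_vectorSpan K hx hy)
  · have hle : vectorSpan K s ≤ LinearMap.ker f := by
      rw [vectorSpan_def, Submodule.span_le]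
      rintro _ ⟨x, hx, y, hy, rfl⟩
      simp [h x hx y hy]
    exact hle hv

theorem finrank_vectorSpan_add_one [FiniteDimensional K E] (hst : s ⊆ t) {f : Module.Dual K E}
    (hs : ∀ x ∈ s, ∀ y ∈ s, f x = f y) (ht : ¬∀ x ∈ t, ∀ y ∈ t, f x = f y)
    (h : ∀ g : Module.Dual K E, (∀ x ∈ s, ∀ y ∈ s, g x = g y) →
      ∃ r : K, ∀ x ∈ t, ∀ y ∈ t, (g - r • f) x = (g - r • f) y) :
    Module.finrank K (vectorSpan K s) + 1 = Module.finrank K (vectorSpan K t) := by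
  have hann : (vectorSpan K s).dualAnnihilator =
      (vectorSpan K t).dualAnnihilator ⊔ K ∙ f := by
    refine le_antisymm (fun g hg => ?_) (sup_le ?_ ?_)
    · obtain ⟨r, hr⟩ := h g (mem_dualAnnihilator_vectorSpan_iff.1 hg)
      rw [← sub_add_cancel g (r • f)]
      exact Submodule.add_mem_sup (mem_dualAnnihilator_vectorSpan_iff.2 hr)
        (Submodule.smul_mem _ r (Submodule.mem_span_singleton_self f))
    · exact Submodule.dualAnnihilator_anti (vectorSpan_mono K hst)
    · rw [Submodule.span_singleton_le_iff_mem]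
      exact mem_dualAnnihilator_vectorSpan_iff.2 hs
  have hf : f ∉ (vectorSpan K t).dualAnnihilator := mt mem_dualAnnihilator_vectorSpan_iff.1 ht
  have hrank := Submodule.finrank_sup_span_singleton hf
  rw [← hann] at hrank
  have hs' := Subspace.finrank_add_finrank_dualAnnihilator_eq (vectorSpan K s)
  have ht' := Subspace.finrank_add_finrank_dualAnnihilator_eq (vectorSpan K t)
  omega

theorem isFacetDefining_of_forall_dotProduct {n : ℕ} {P : Set (Fin n → ℝ)} {a : Fin n → ℝ} {b : ℝ}
    (hle : ∀ x ∈ P, a ⬝ᵥ x ≤ b) (hne : {x ∈ P | a ⬝ᵥ x = b}.Nonempty)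
    (ha : ¬∀ x ∈ P, ∀ y ∈ P, a ⬝ᵥ x = a ⬝ᵥ y)
    (h : ∀ c : Fin n → ℝ,
      (∀ x ∈ {x ∈ P | a ⬝ᵥ x = b}, ∀ y ∈ {x ∈ P | a ⬝ᵥ x = b}, c ⬝ᵥ x = c ⬝ᵥ y) →
        ∃ r : ℝ, ∀ x ∈ P, ∀ y ∈ P, (c - r • a) ⬝ᵥ x = (c - r • a) ⬝ᵥ y) :
    IsFacetDefining P a b := by
  refine ⟨hne, fun _ => ⟨LinearMap.toContinuousLinearMap (dotProductEquiv ℝ (Fin n) a), ?_⟩,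
    finrank_vectorSpan_add_one (f := dotProductEquiv ℝ (Fin n) a) (fun x hx => hx.1)
      (fun x hx y hy => hx.2.trans hy.2.symm) ha fun g hg => ?_⟩
  · obtain ⟨v, hv, hvb⟩ := hne
    ext x
    refine and_congr_right fun hx =>
      ⟨fun hxb y hy => (hle y hy).trans_eq hxb.symm, fun hmax => ?_⟩
    exact (hle x hx).antisymm (hvb.symm.trans_le (hmax v hv))
  · obtain ⟨c, rfl⟩ := (dotProductEquiv ℝ (Fin n)).surjective g
    obtain ⟨r, hr⟩ := h c hg
    refine ⟨r, ?_⟩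
    rw [← map_smul, ← map_sub]
    exact hr

end Codimension

section Facets

variable {d : ℕ} {α : Fin (d + 1) → ℝ} {β : Fin d → ℝ} {σ : Equiv.Perm (Fin (d + 1))}
  {P : ℕ → Prop} [DecidablePred P] {c : Fin (d + 1) → ℝ}

theorem vertex_sub_vertex_mul_swap (π : Equiv.Perm (Fin (d + 1))) {T : BinaryTree Unit}
    (hT : T.numNodes = d) {x y : Fin (d + 1)} (hxy : x ≠ y) :
    vertex α β π T - vertex α β (π * Equiv.swap x y) T =
      (coeff α β T (π x) - coeff α β T (π y)) • (Pi.single x 1 - Pi.single y 1) := by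
  ext z
  simp only [Pi.sub_apply, Pi.smul_apply, vertex_apply _ hT, Equiv.Perm.mul_apply,
    Equiv.swap_apply_def, Pi.single_apply, smul_eq_mul]
  split_ifs with hx hy hy
  · exact absurd (hx.symm.trans hy) hxy
  · rw [hx]; ring
  · rw [hy]; ring
  · ring

theorem eq_of_dotProduct_vertex_mul_swap_eq {T : BinaryTree Unit} (hT : T.numNodes = d)
    (hcoeff : StrictMono (coeff α β T)) {π : Equiv.Perm (Fin (d + 1))} {x y : Fin (d + 1)}
    (h : c ⬝ᵥ vertex α β π T = c ⬝ᵥ vertex α β (π * Equiv.swap x y) T) : c x = c y := by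
  by_contra hc
  have hxy : x ≠ y := fun hxy => hc (congrArg c hxy)
  rw [← sub_eq_zero, ← dotProduct_sub, vertex_sub_vertex_mul_swap π hT hxy, dotProduct_smul,
    dotProduct_sub, dotProduct_single_one, dotProduct_single_one, smul_eq_mul, mul_eq_zero,
    sub_eq_zero, sub_eq_zero] at h
  exact h.elim (fun hπ => hxy (π.injective (hcoeff.injective hπ))) hc

/-- The part of `PermAsso(α, β)` on which the inequality of `𝒮` is an equality. -/
def face (α : Fin (d + 1) → ℝ) (β : Fin d → ℝ) (S : OrderedSetPartition (d + 1)) :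
    Set (Fin (d + 1) → ℝ) :=
  {x ∈ permAsso α β | S.eVec ⬝ᵥ x = bound α β S}

theorem IsHeap.vertex_inv_mem_face {T : BinaryTree Unit} (hheap : IsHeap T (zeroOne P))
    (hT : T.numNodes = d) (σ : Equiv.Perm (Fin (d + 1))) :
    vertex α β σ⁻¹ T ∈ face α β (OrderedSetPartition.ofCuts σ P) :=
  ⟨vertex_mem_permAsso σ⁻¹ hT, hheap.eVec_dotProduct_vertex_eq_bound hT⟩

theorem apply_eq_apply_of_constOn_face
    (hcoeff : ∀ T : BinaryTree Unit, T.numNodes = d → StrictMono (coeff α β T))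
    (hc : ∀ x ∈ face α β (OrderedSetPartition.ofCuts σ P),
      ∀ y ∈ face α β (OrderedSetPartition.ofCuts σ P), c ⬝ᵥ x = c ⬝ᵥ y)
    {p q : Fin (d + 1)} (hpq : Nat.count P p = Nat.count P q) : c (σ p) = c (σ q) := by
  obtain ⟨T, hT, hheap⟩ := exists_isHeap d (zeroOne P)
  have hswap := hheap.vertex_inv_mem_face (α := α) (β := β) hT (Equiv.swap (σ p) (σ q) * σ)
  rw [OrderedSetPartition.ofCuts_swap_mul σ hpq, mul_inv_rev, Equiv.swap_inv] at hswap
  exact eq_of_dotProduct_vertex_mul_swap_eq hT (hcoeff T hT)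
    (hc _ (hheap.vertex_inv_mem_face hT σ) _ hswap)

theorem jump_eq_jump_of_constOn_face (hβ : StrictMono β)
    (hc : ∀ x ∈ face α β (OrderedSetPartition.ofCuts σ P),
      ∀ y ∈ face α β (OrderedSetPartition.ofCuts σ P), c ⬝ᵥ x = c ⬝ᵥ y)
    {g : ℕ → ℝ} (hg : ∀ p : Fin (d + 1), c (σ p) = g p) {i j : ℕ} (hi : i < d) (hj : j < d)
    (hPi : P i) (hPj : P j) : g (i + 1) - g i = g (j + 1) - g j := by
  wlog hij : i < j generalizing i j
  · rcases (not_lt.1 hij).eq_or_lt with rfl | hji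
    · rfl
    · exact (this hj hi hPj hPi hji).symm
  obtain ⟨T₁, T₂, hT₁, hT₂, hheap₁, hheap₂, κ, hκ, hdiff⟩ := exists_isHeap_rotate hβ hij hj hPi hPj
  have heq := hc _ (hheap₁.vertex_inv_mem_face hT₁ σ) _ (hheap₂.vertex_inv_mem_face hT₂ σ)
  rw [dotProduct_vertex_inv hg hT₁, dotProduct_vertex_inv hg hT₂, add_right_inj, ← sub_eq_zero,
    hdiff, mul_eq_zero, or_iff_left hκ] at heq
  exact sub_eq_zero.1 heq

theorem exists_eq_smul_eVec_add_of_constOn_face (hβ : StrictMono β)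
    (hcoeff : ∀ T : BinaryTree Unit, T.numNodes = d → StrictMono (coeff α β T))
    (hS : (OrderedSetPartition.ofCuts σ P).Nontrivial)
    (hc : ∀ x ∈ face α β (OrderedSetPartition.ofCuts σ P),
      ∀ y ∈ face α β (OrderedSetPartition.ofCuts σ P), c ⬝ᵥ x = c ⬝ᵥ y) :
    ∃ r s : ℝ, c = r • (OrderedSetPartition.ofCuts σ P).eVec + fun _ => s := by
  let g : ℕ → ℝ := fun p => c (σ (Fin.clamp p d))
  have hcg : ∀ p : Fin (d + 1), c (σ p) = g p := fun p => by simp only [g, clamp_val]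
  obtain ⟨k, hk, hPk⟩ := OrderedSetPartition.exists_cut_of_nontrivial hS
  have hjump : ∀ i < d, g (i + 1) - g i = (g (k + 1) - g k) * zeroOne P i := fun i hi => by
    rw [zeroOne]
    split_ifs with hPi
    · rw [mul_one, jump_eq_jump_of_constOn_face hβ hc hcg hi hk hPi hPk]
    · have hsame := apply_eq_apply_of_constOn_face (σ := σ) hcoeff hc
        (p := ⟨i + 1, by omega⟩) (q := ⟨i, by omega⟩)
        (by simp [Nat.count_succ, hPi])
      rw [hcg, hcg] at hsame
      rw [mul_zero, hsame, sub_self]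
  have hg : ∀ p : Fin (d + 1), g p - g 0 = (g (k + 1) - g k) * Nat.count P p := fun p => by
    rw [← Finset.sum_range_sub, ← sum_range_zeroOne, Finset.mul_sum]
    exact Finset.sum_congr rfl fun i hi => hjump i (by rw [Finset.mem_range] at hi; omega)
  refine ⟨g (k + 1) - g k, g 0 - (g (k + 1) - g k), funext fun x => ?_⟩
  obtain ⟨p, rfl⟩ := σ.surjective x
  rw [Pi.add_apply, Pi.smul_apply, OrderedSetPartition.eVec_ofCuts_apply, smul_eq_mul, hcg]
  linarith [hg p]

theorem const_dotProduct_of_mem_U (s : ℝ) {x : Fin (d + 1) → ℝ} (hx : x ∈ U α) :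
    (fun _ => s) ⬝ᵥ x = s * ∑ i, α i := by
  rw [← show ∑ i, x i = ∑ i, α i from hx, Finset.mul_sum, dotProduct]

theorem eVec_dotProduct_not_const
    (hcoeff : ∀ T : BinaryTree Unit, T.numNodes = d → StrictMono (coeff α β T))
    (hS : (OrderedSetPartition.ofCuts σ P).Nontrivial) :
    ¬∀ x ∈ permAsso α β, ∀ y ∈ permAsso α β,
      (OrderedSetPartition.ofCuts σ P).eVec ⬝ᵥ x = (OrderedSetPartition.ofCuts σ P).eVec ⬝ᵥ y :=
  fun h => by
    obtain ⟨i, hi, hPi⟩ := OrderedSetPartition.exists_cut_of_nontrivial hS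
    obtain ⟨T, hT, -⟩ := exists_isHeap d 0
    have heq := eq_of_dotProduct_vertex_mul_swap_eq (π := 1) (x := σ ⟨i, by omega⟩)
      (y := σ ⟨i + 1, by omega⟩) hT (hcoeff T hT)
      (h _ (vertex_mem_permAsso _ hT) _ (vertex_mem_permAsso _ hT))
    simp [OrderedSetPartition.eVec_ofCuts_apply, Nat.count_succ, hPi] at heq

theorem isFacetDefining_eVec (hβ : StrictMono β)
    (hcoeff : ∀ T : BinaryTree Unit, T.numNodes = d → StrictMono (coeff α β T))
    {S : OrderedSetPartition (d + 1)} (hS : S.Nontrivial) :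
    IsFacetDefining (permAsso α β) S.eVec (bound α β S) := by
  obtain ⟨σ, P, _, rfl⟩ := S.exists_eq_ofCuts
  obtain ⟨T, hT, hheap⟩ := exists_isHeap d (zeroOne P)
  refine isFacetDefining_of_forall_dotProduct
    (fun x hx => eVec_dotProduct_le_bound hβ.monotone (fun T hT => (hcoeff T hT).monotone) _ hx)
    ⟨_, hheap.vertex_inv_mem_face hT σ⟩ (eVec_dotProduct_not_const hcoeff hS) fun c hc => ?_
  obtain ⟨r, s, rfl⟩ := exists_eq_smul_eVec_add_of_constOn_face hβ hcoeff hS hc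
  refine ⟨r, fun x hx y hy => ?_⟩
  rw [add_sub_cancel_left, const_dotProduct_of_mem_U s (permAsso_subset_U hx),
    const_dotProduct_of_mem_U s (permAsso_subset_U hy)]

end Facets

end

end NestedPermutoAssociahedron

theorem theorem6p5_general (d : ℕ) (α : Fin (d + 1) → ℝ) (β : Fin d → ℝ)
    (hβ : StrictMono β)
    (hcoeff : ∀ T : BinaryTree Unit, T.numNodes = d →
      StrictMono (NestedPermutoAssociahedron.coeff α β T)) :
    NestedPermutoAssociahedron.permAsso α β =
        {x ∈ NestedPermutoAssociahedron.U α |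
          ∀ S : NestedPermutoAssociahedron.OrderedSetPartition (d + 1), S.Nontrivial →
            S.eVec ⬝ᵥ x ≤ NestedPermutoAssociahedron.bound α β S} ∧
      ∀ S : NestedPermutoAssociahedron.OrderedSetPartition (d + 1), S.Nontrivial →
        NestedPermutoAssociahedron.IsFacetDefining (NestedPermutoAssociahedron.permAsso α β)
          S.eVec (NestedPermutoAssociahedron.bound α β S) :=
  ⟨NestedPermutoAssociahedron.permAsso_eq hβ.monotone fun T hT => (hcoeff T hT).monotone,
    fun _ hS => NestedPermutoAssociahedron.isFacetDefining_eVec hβ hcoeff hS⟩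

theorem theorem6p5 (d : ℕ) (α : Fin (d + 1) → ℝ) (β : Fin d → ℝ)
    (h : NestedPermutoAssociahedron.IsTreeAppropriate α β) :
    NestedPermutoAssociahedron.permAsso α β =
        {x ∈ NestedPermutoAssociahedron.U α |
          ∀ S : NestedPermutoAssociahedron.OrderedSetPartition (d + 1), S.Nontrivial →
            S.eVec ⬝ᵥ x ≤ NestedPermutoAssociahedron.bound α β S} ∧
      ∀ S : NestedPermutoAssociahedron.OrderedSetPartition (d + 1), S.Nontrivial →
        NestedPermutoAssociahedron.IsFacetDefining (NestedPermutoAssociahedron.permAsso α β)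
          S.eVec (NestedPermutoAssociahedron.bound α β S) :=
  theorem6p5_general d α β h.strictMono_right h.strictMono_coeff
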